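/- For random variables $X,Y$ on the same probability space, let $I(X;Y)=\mathbb E\left[\log\frac{\mathrm dP_{(X,Y)}}{\mathrm d(P_X\otimes P_Y)}(X,Y)\right]$ denote their mutual information (natural logarithm). Let $S$ be a random variable taking values in a finite set $\mathcal S$, let $n\ge 1$, and for every $i\in\{1,\dots,n\}$ let $f_i:\mathcal S\to\mathbb R^{d_i}$. Let $(W_i,W_i')_{1\le i\le n}$ be independent standard Gaussian random vectors, independent of $S$, with $W_i$ and $W_i'$ of dimension $d_i$. For $t\ge 0$ define $$X_i(t)=\sqrt t\, f_i(S)+W_i,\qquad X_i'(t)=\sqrt t\, f_i(S)+W_i'.$$ Let $C_{ij}=\mathbb E\big[(f_i(S)-\mathbb E f_i(S))(f_j(S)-\mathbb E f_j(S))^*\big]$, where ${}^*$ is the transpose, and let $|\cdot|$ be the Frobenius norm of matrices. Then for all $i,j\in\{1,\dots,n\}$, the mutual information $I(X_i(t);X_j'(t))$ is finite for every $t\ge0$, and $$\lim_{t\to 0,\ t>0} t^{-2}\, I(X_i(t);X_j'(t))=\tfrac12\,|C_{ij}|^2 .$$ Moreover, the $n\times n$ matrix $\big(|C_{ij}|^2\big)_{1\le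 i,j\le n}$ is positive semidefinite (and so, in particular, is the matrix of the above limits). -/

import Mathlib

open MeasureTheory ProbabilityTheory Filter Topology

noncomputable section

/-- The mutual information `I(X;Y)` (natural logarithm), i.e. the relative entropy of the joint
law `P_(X,Y)` with respect to the product `P_X ⊗ P_Y` of the marginal laws. When `P_(X,Y)` is
absolutely continuous with respect to `P_X ⊗ P_Y` with integrable log-density, it is the
expectation of `log (d P_(X,Y) / d (P_X ⊗ P_Y)) (X,Y)`, and otherwise it is `∞`;
see `mutualInfo_toReal_eq`. -/
def mutualInfo {Ω α β : Type*} [MeasurableSpace Ω] [MeasurableSpace α] [MeasurableSpace β]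
    (X : Ω → α) (Y : Ω → β) (μ : Measure Ω) : ENNReal :=
  InformationTheory.klDiv (μ.map (fun ω => (X ω, Y ω))) ((μ.map X).prod (μ.map Y))

/-- A finite mutual information is the expected log-density of the joint law with respect to
the product of the marginal laws. -/
theorem mutualInfo_toReal_eq {Ω α β : Type*} [MeasurableSpace Ω] [MeasurableSpace α]
    [MeasurableSpace β] (X : Ω → α) (Y : Ω → β) (μ : Measure Ω) [IsProbabilityMeasure μ]
    (hX : AEMeasurable X μ) (hY : AEMeasurable Y μ) (h : mutualInfo X Y μ ≠ ⊤) :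
    (mutualInfo X Y μ).toReal =
      ∫ ω, Real.log ((μ.map (fun ω => (X ω, Y ω))).rnDeriv
        ((μ.map X).prod (μ.map Y)) (X ω, Y ω)).toReal ∂μ := by
  have hXY : AEMeasurable (fun ω => (X ω, Y ω)) μ := hX.prodMk hY
  have := Measure.isProbabilityMeasure_map hX
  have := Measure.isProbabilityMeasure_map hY
  have := Measure.isProbabilityMeasure_map hXY
  have hac := (InformationTheory.klDiv_ne_top_iff.mp h).1
  unfold mutualInfo
  rw [InformationTheory.toReal_klDiv_of_measure_eq hac (by simp), integral_map hXY]
  · rfl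
  · exact (measurable_llr _ _).aestronglyMeasurable

/-- The output `√t f(S) + W` of a Gaussian channel at signal-to-noise ratio `t`. -/
def gaussianOutput {Ω 𝒮 : Type*} {d : ℕ} (f : 𝒮 → EuclideanSpace ℝ (Fin d)) (S : Ω → 𝒮)
    (W : Ω → EuclideanSpace ℝ (Fin d)) (t : ℝ) : Ω → EuclideanSpace ℝ (Fin d) :=
  fun ω => Real.sqrt t • f (S ω) + W ω

/-- The cross-covariance matrix `E[(U - E U) (V - E V)^*]`, with entries
`E[(U - E U)_a (V - E V)_b]`. -/
def crossCov {Ω : Type*} [MeasurableSpace Ω] {d e : ℕ} (U : Ω → EuclideanSpace ℝ (Fin d))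
    (V : Ω → EuclideanSpace ℝ (Fin e)) (μ : Measure Ω) : Matrix (Fin d) (Fin e) ℝ :=
  Matrix.of fun a b => ∫ ω, (U ω - ∫ ω', U ω' ∂μ) a * (V ω - ∫ ω', V ω' ∂μ) b ∂μ

section

open scoped Matrix.Norms.Frobenius

/-- The Frobenius norm of a real matrix. -/
def frobeniusNorm {d e : ℕ} (A : Matrix (Fin d) (Fin e) ℝ) : ℝ := ‖A‖

end

end

/-!
Let `ε = √t`, and take the law of the noise `(W i, W' j)`, a product of standard Gaussian measures,
as the reference measure. By the Cameron–Martin formula (`stdGaussian_map_const_add`) the joint law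
of the two outputs has the density `p = E[L_{ε u}(x) L_{ε v}(y)]` and the product of their laws has
the density `q = E[L_{ε u}(x)] E[L_{ε v}(y)]`, where `u = f i S`, `v = f j S`, the expectation is over
`S`, and `L_w(x) = exp (⟪w, x⟫ - ‖w‖ ^ 2 / 2)`. So the mutual information is the integral of
`q * klFun (p / q)` (`mutualInfo_gaussianOutput`).

The point is that `p - q` is the covariance of `L_{ε u}(x) - 1` and `L_{ε v}(y) - 1`, two functions of
order `ε`, so that `(p - q) / ε ^ 2` tends to `Cov(⟪u, x⟫, ⟪v, y⟫) = ⟪x, C y⟫`. As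
`klFun (1 + h) ∼ h ^ 2 / 2`, the integrand divided by `ε ^ 4 = t ^ 2` tends to `⟪x, C y⟫ ^ 2 / 2`
(`tendsto_infoIntegrand_smul`). The inequality `klFun r ≤ (r - 1) ^ 2` bounds the quotient by the
exponential of a linear function of `‖x‖` and `‖y‖`, uniformly in `ε ≤ 1` (`infoIntegrand_smul_le`),
and this is integrable by Fernique's theorem. The same bound gives the finiteness, and dominated
convergence gives the limit `1 / 2 * ∫ ⟪x, C y⟫ ^ 2`, which is half the squared Frobenius norm of `C`
since the noises have identity covariance (`integral_bilin_sq_stdGaussian`).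

The matrix of the squared Frobenius norms is positive semidefinite by the Schur product theorem,
applied to the covariance matrix of all the coordinates of all the signals
(`posSemidef_sum_sq_covariance`).
-/

noncomputable section

open InformationTheory
open scoped RealInnerProductSpace

/-! ### Standard Gaussian measures -/

/-- The likelihood ratio of the Gaussian law `𝒩(w, 1)` with respect to `𝒩(0, 1)` at the point `z`
of a Euclidean space. -/
def gaussianLik {E : Type*} [NormedAddCommGroup E] [InnerProductSpace ℝ E] (w z : E) : ℝ :=
  Real.exp (⟪w, z⟫ - ‖w‖ ^ 2 / 2)

theorem gaussianReal_one_eq_withDensity (m : ℝ) :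
    gaussianReal m 1 =
      (gaussianReal 0 1).withDensity (fun x => ENNReal.ofReal (Real.exp (m * x - m ^ 2 / 2))) := by
  rw [gaussianReal_of_var_ne_zero _ one_ne_zero, gaussianReal_of_var_ne_zero _ one_ne_zero,
    ← withDensity_mul _ (measurable_gaussianPDF _ _) (by fun_prop)]
  congr 1
  ext x
  rw [Pi.mul_apply, gaussianPDF, gaussianPDF,
    ← ENNReal.ofReal_mul (gaussianPDFReal_nonneg _ _ _), gaussianPDFReal, gaussianPDFReal,
    mul_assoc (√(2 * Real.pi * _))⁻¹, ← Real.exp_add]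
  congr 3
  simp
  ring

theorem pi_withDensity {ι : Type*} [Fintype ι] {α : ι → Type*} [∀ i, MeasurableSpace (α i)]
    (ν : (i : ι) → Measure (α i)) [∀ i, IsProbabilityMeasure (ν i)]
    {g : (i : ι) → α i → ENNReal} (hg : ∀ i, Measurable (g i))
    [∀ i, SigmaFinite ((ν i).withDensity (g i))] :
    Measure.pi (fun i => (ν i).withDensity (g i)) =
      (Measure.pi ν).withDensity (fun x => ∏ i, g i (x i)) := by
  refine Measure.pi_eq fun s hs => ?_
  have hind : iIndepFun (fun i (x : (i : ι) → α i) => (s i).indicator (g i) (x i))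
      (Measure.pi ν) :=
    iIndepFun_pi fun i => ((hg i).indicator (hs i)).aemeasurable
  rw [withDensity_apply _ (MeasurableSet.univ_pi hs),
    ← lintegral_indicator (MeasurableSet.univ_pi hs)]
  have hprod : (Set.univ.pi s).indicator (fun x => ∏ i, g i (x i)) =
      fun x => ∏ i, (s i).indicator (g i) (x i) := by
    ext x
    by_cases hx : x ∈ Set.univ.pi s
    · rw [Set.indicator_of_mem hx]
      exact Finset.prod_congr rfl fun i _ => (Set.indicator_of_mem (hx i trivial) _).symm
    · rw [Set.indicator_of_notMem hx]
      obtain ⟨i, hi⟩ : ∃ i, x i ∉ s i := by simpa using hx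
      exact (Finset.prod_eq_zero (Finset.mem_univ i) (Set.indicator_of_notMem hi _)).symm
  rw [hprod, lintegral_prod_eq_prod_lintegral_of_indepFun _ _ hind fun i =>
    ((hg i).indicator (hs i)).comp (measurable_pi_apply i)]
  refine Finset.prod_congr rfl fun i _ => ?_
  rw [withDensity_apply _ (hs i), ← lintegral_indicator (hs i),
    ← (measurePreserving_eval ν i).lintegral_comp ((hg i).indicator (hs i))]

/-- The Cameron–Martin formula for the standard Gaussian measure. -/
theorem stdGaussian_map_const_add {d : ℕ} (w : EuclideanSpace ℝ (Fin d)) :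
    (stdGaussian (EuclideanSpace ℝ (Fin d))).map (fun x => w + x) =
      (stdGaussian (EuclideanSpace ℝ (Fin d))).withDensity
        (fun x => ENNReal.ofReal (gaussianLik w x)) := by
  have hlik : ∀ x : Fin d → ℝ, ENNReal.ofReal (gaussianLik w (WithLp.toLp 2 x)) =
      ∏ i, ENNReal.ofReal (Real.exp (w i * x i - w i ^ 2 / 2)) := fun x => by
    rw [← ENNReal.ofReal_prod_of_nonneg fun i _ => (Real.exp_pos _).le, ← Real.exp_sum,
      gaussianLik, EuclideanSpace.real_norm_sq_eq, Finset.sum_sub_distrib, Finset.sum_div]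
    simp [PiLp.inner_apply, mul_comm]
  have hshift : (Measure.pi fun i : Fin d => gaussianReal 0 1).map (fun x i => w i + x i) =
      (Measure.pi fun i : Fin d => gaussianReal 0 1).withDensity
        (fun x => ∏ i, ENNReal.ofReal (Real.exp (w i * x i - w i ^ 2 / 2))) := by
    rw [Measure.pi_map_pi (f := fun i y => w i + y) fun i => by fun_prop]
    simp_rw [gaussianReal_map_const_add, zero_add]
    have : ∀ i : Fin d, SigmaFinite ((gaussianReal 0 1).withDensity
        (fun x => ENNReal.ofReal (Real.exp (w i * x - w i ^ 2 / 2)))) := fun i => by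
      rw [← gaussianReal_one_eq_withDensity]
      infer_instance
    rw [← pi_withDensity (fun _ => gaussianReal 0 1)
      (g := fun i y => ENNReal.ofReal (Real.exp (w i * y - w i ^ 2 / 2))) fun i => by fun_prop]
    exact congrArg _ (funext fun i => gaussianReal_one_eq_withDensity (w i))
  have hm : Measurable (fun x => ENNReal.ofReal (gaussianLik w x)) := by
    unfold gaussianLik
    fun_prop
  rw [← map_pi_eq_stdGaussian, Measure.map_map (by fun_prop) (by fun_prop)]
  have hcomp : (fun x : EuclideanSpace ℝ (Fin d) => w + x) ∘ WithLp.toLp 2 =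
      WithLp.toLp 2 ∘ fun (x : Fin d → ℝ) i => w i + x i := by
    ext x i
    simp
  rw [hcomp, ← Measure.map_map (by fun_prop) (by fun_prop), hshift]
  ext A hA
  rw [Measure.map_apply (by fun_prop) hA, withDensity_apply _ hA,
    withDensity_apply _ (WithLp.measurable_toLp 2 _ hA),
    setLIntegral_map hA hm (by fun_prop)]
  simp_rw [hlik]

theorem integrable_exp_mul_norm_stdGaussian {d : ℕ} (K : ℝ) :
    Integrable (fun x => Real.exp (K * ‖x‖)) (stdGaussian (EuclideanSpace ℝ (Fin d))) := by
  obtain ⟨c, hc, hint⟩ :=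
    IsGaussian.exists_integrable_exp_sq (stdGaussian (EuclideanSpace ℝ (Fin d)))
  refine (hint.const_mul (Real.exp (K ^ 2 / (4 * c)))).mono'
    (Measurable.aestronglyMeasurable (by fun_prop)) (ae_of_all _ fun x => ?_)
  rw [Real.norm_of_nonneg (Real.exp_pos _).le, ← Real.exp_add, Real.exp_le_exp]
  -- complete the square in `c ‖x‖ ^ 2 - K ‖x‖ + K ^ 2 / (4 c)`
  have : K ^ 2 / (4 * c) + c * ‖x‖ ^ 2 - K * ‖x‖ = c * (‖x‖ - K / (2 * c)) ^ 2 := by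
    field_simp
    ring
  nlinarith [mul_nonneg hc.le (sq_nonneg (‖x‖ - K / (2 * c)))]

theorem integrable_coord_mul_coord_stdGaussian {d : ℕ} (a b : Fin d) :
    Integrable (fun x => x a * x b) (stdGaussian (EuclideanSpace ℝ (Fin d))) := by
  have h : ∀ i : Fin d, MemLp (fun x : EuclideanSpace ℝ (Fin d) => x i) 2
      (stdGaussian (EuclideanSpace ℝ (Fin d))) := fun i =>
    (EuclideanSpace.proj i : EuclideanSpace ℝ (Fin d) →L[ℝ] ℝ).comp_memLp'
      IsGaussian.memLp_two_id
  exact (h a).integrable_mul (h b)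

theorem integral_coord_mul_coord_stdGaussian {d : ℕ} (a b : Fin d) :
    ∫ x, x a * x b ∂stdGaussian (EuclideanSpace ℝ (Fin d)) = if a = b then 1 else 0 := by
  have h := covariance_eval_multivariateGaussian (μ := 0) (S := (1 : Matrix (Fin d) (Fin d) ℝ))
    Matrix.PosSemidef.one a b
  have h0 : ∀ i : Fin d, ∫ x, x i ∂stdGaussian (EuclideanSpace ℝ (Fin d)) = 0 := fun i =>
    integral_strongDual_stdGaussian (EuclideanSpace.proj i : EuclideanSpace ℝ (Fin d) →L[ℝ] ℝ)
  rw [multivariateGaussian_zero_one, covariance, Matrix.one_apply] at h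
  simpa only [h0, sub_zero] using h

/-! ### Mixtures of densities and relative entropy -/

/-- If every shift `T s` transports `ν` to the measure of density `L s`, then a random shift that
is independent of the shifted variable transports `ν` to the measure whose density is the mixture
of the `L s`. -/
theorem map_randomShift_eq_withDensity {Ω 𝒮 α : Type*} [MeasurableSpace Ω] [MeasurableSpace α]
    {μ : Measure Ω} [IsProbabilityMeasure μ] [Finite 𝒮] [MeasurableSpace 𝒮]
    [MeasurableSingletonClass 𝒮] {S : Ω → 𝒮} (hS : Measurable S)
    {ν : Measure α} [IsProbabilityMeasure ν] {Z : Ω → α} (hZ : HasLaw Z ν μ)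
    (hSZ : IndepFun S Z μ) {T : 𝒮 → α → α} (hT : ∀ s, Measurable (T s))
    {L : 𝒮 → α → ℝ} (hL : ∀ s, Measurable (L s)) (hL0 : ∀ s z, 0 ≤ L s z)
    (hTL : ∀ s, ν.map (T s) = ν.withDensity (fun z => ENNReal.ofReal (L s z))) :
    μ.map (fun ω => T (S ω) (Z ω)) =
      ν.withDensity (fun z => ENNReal.ofReal (∫ s, L s z ∂(μ.map S))) := by
  have := Measure.isProbabilityMeasure_map (μ := μ) hS.aemeasurable
  have hTm : Measurable (fun p : 𝒮 × α => T p.1 p.2) := measurable_from_prod_countable_right hT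
  have hLm : Measurable (fun p : 𝒮 × α => ENNReal.ofReal (L p.1 p.2)) :=
    (measurable_from_prod_countable_right (f := fun p : 𝒮 × α => L p.1 p.2) hL).ennreal_ofReal
  have hlaw : HasLaw (fun ω => (S ω, Z ω)) ((μ.map S).prod ν) μ :=
    hSZ.hasLaw_prod ⟨hS.aemeasurable, rfl⟩ hZ
  have hcomp : (fun ω => T (S ω) (Z ω)) = (fun p : 𝒮 × α => T p.1 p.2) ∘ fun ω => (S ω, Z ω) := rfl
  rw [hcomp, ← AEMeasurable.map_map_of_aemeasurable hTm.aemeasurable hlaw.aemeasurable, hlaw.map_eq]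
  ext A hA
  rw [Measure.map_apply hTm hA, Measure.prod_apply (hTm hA), withDensity_apply _ hA]
  have h1 : ∀ s, ν (Prod.mk s ⁻¹' ((fun p : 𝒮 × α => T p.1 p.2) ⁻¹' A)) =
      ∫⁻ z in A, ENNReal.ofReal (L s z) ∂ν := fun s => by
    rw [← withDensity_apply _ hA, ← hTL, Measure.map_apply (hT s) hA]
    rfl
  simp_rw [h1]
  rw [lintegral_lintegral_swap hLm.aemeasurable]
  refine lintegral_congr fun z => ?_
  rw [ofReal_integral_eq_lintegral_ofReal .of_finite (ae_of_all _ fun s => hL0 s z)]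

theorem klDiv_withDensity_withDensity {α : Type*} [MeasurableSpace α] {ν : Measure α}
    [SigmaFinite ν] {p q : α → ℝ} (hp : Measurable p) (hq : Measurable q) (hp0 : ∀ z, 0 ≤ p z)
    (hq0 : ∀ z, 0 < q z)
    [IsFiniteMeasure (ν.withDensity fun z => ENNReal.ofReal (p z))]
    [IsFiniteMeasure (ν.withDensity fun z => ENNReal.ofReal (q z))] :
    klDiv (ν.withDensity fun z => ENNReal.ofReal (p z))
        (ν.withDensity fun z => ENNReal.ofReal (q z)) =
      ∫⁻ z, ENNReal.ofReal (q z * klFun (p z / q z)) ∂ν := by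
  have hrat : Measurable fun z => ENNReal.ofReal (p z / q z) := (hp.div hq).ennreal_ofReal
  have heq : (ν.withDensity fun z => ENNReal.ofReal (p z)) =
      (ν.withDensity fun z => ENNReal.ofReal (q z)).withDensity
        fun z => ENNReal.ofReal (p z / q z) := by
    rw [← withDensity_mul _ hq.ennreal_ofReal hrat]
    congr 1
    ext z
    rw [Pi.mul_apply, ← ENNReal.ofReal_mul (hq0 z).le, mul_div_cancel₀ _ (hq0 z).ne']
  have hac : (ν.withDensity fun z => ENNReal.ofReal (p z)) ≪
      ν.withDensity fun z => ENNReal.ofReal (q z) := by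
    rw [heq]
    exact withDensity_absolutelyContinuous _ _
  have hderiv : (ν.withDensity fun z => ENNReal.ofReal (p z)).rnDeriv
      (ν.withDensity fun z => ENNReal.ofReal (q z))
      =ᵐ[ν.withDensity fun z => ENNReal.ofReal (q z)] fun z => ENNReal.ofReal (p z / q z) := by
    rw [heq]
    exact Measure.rnDeriv_withDensity _ hrat
  rw [klDiv_eq_lintegral_klFun_of_ac hac]
  calc _ = ∫⁻ z, ENNReal.ofReal (klFun (p z / q z))
        ∂(ν.withDensity fun z => ENNReal.ofReal (q z)) := by
        refine lintegral_congr_ae ?_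
        filter_upwards [hderiv] with z hz
        rw [hz, ENNReal.toReal_ofReal (div_nonneg (hp0 z) (hq0 z).le)]
    _ = _ := by
        have hkl : Measurable fun z => ENNReal.ofReal (klFun (p z / q z)) :=
          (measurable_klFun.comp (hp.div hq)).ennreal_ofReal
        rw [lintegral_withDensity_eq_lintegral_mul _ hq.ennreal_ofReal hkl]
        refine lintegral_congr fun z => ?_
        rw [Pi.mul_apply, ← ENNReal.ofReal_mul (hq0 z).le]

/-! ### The function `klFun` near `1` -/

theorem klFun_le_sub_one_sq {r : ℝ} (hr : 0 ≤ r) : klFun r ≤ (r - 1) ^ 2 := by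
  rw [klFun_apply]
  rcases hr.eq_or_lt with rfl | hr
  · simp
  · nlinarith [Real.log_le_sub_one_of_pos hr]

theorem mul_klFun_div_le {p q : ℝ} (hp : 0 ≤ p) (hq : 0 < q) :
    q * klFun (p / q) ≤ (p - q) ^ 2 / q := by
  calc q * klFun (p / q) ≤ q * (p / q - 1) ^ 2 :=
        mul_le_mul_of_nonneg_left (klFun_le_sub_one_sq (div_nonneg hp hq.le)) hq.le
    _ = (p - q) ^ 2 / q := by field_simp

/-- The second-order expansion of `klFun` at `1`. Giving the quotient its limit value at `h = 0`
lets `klFun (1 + h)` be factored as this quotient times `h ^ 2` for all `h`, so that increments that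
vanish need no separate treatment. -/
theorem tendsto_klFun_one_add_div_sq :
    Tendsto (fun h : ℝ => if h = 0 then (1 / 2 : ℝ) else klFun (1 + h) / h ^ 2) (𝓝 0)
      (𝓝 (1 / 2)) := by
  rw [tendsto_iff_norm_sub_tendsto_zero]
  have hlim : Tendsto (fun h : ℝ => 4 * |h|) (𝓝 0) (𝓝 0) := by
    have : Continuous fun h : ℝ => 4 * |h| := by fun_prop
    simpa using this.tendsto 0
  refine squeeze_zero' (Eventually.of_forall fun _ => norm_nonneg _) ?_ hlim
  filter_upwards [Metric.ball_mem_nhds (0 : ℝ) (by norm_num : (0 : ℝ) < 1 / 2)] with h hh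
  have hh : |h| < 1 / 2 := by simpa using hh
  by_cases h0 : h = 0
  · simp [h0]
  rw [if_neg h0]
  -- the cubic Taylor bound for `log (1 - x)` at `x = -h`
  have hlog := Real.abs_log_sub_add_sum_range_le (x := -h) (by rw [abs_neg]; linarith) 2
  simp only [Finset.sum_range_succ, Finset.sum_range_zero, abs_neg, sub_neg_eq_add] at hlog
  norm_num at hlog
  have hpos : 0 < |h| := abs_pos.mpr h0
  have hr : |-h + h ^ 2 / 2 + Real.log (1 + h)| ≤ 2 * |h| ^ 3 := by
    refine hlog.trans ?_
    rw [div_le_iff₀ (by linarith)]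
    nlinarith [pow_pos hpos 3]
  have hsq : |h| ^ 2 = h ^ 2 := sq_abs h
  have hkl : klFun (1 + h) / h ^ 2 - 1 / 2 =
      (-h ^ 3 / 2 + (1 + h) * (-h + h ^ 2 / 2 + Real.log (1 + h))) / h ^ 2 := by
    rw [klFun_apply]
    field_simp
    ring
  rw [Real.norm_eq_abs, hkl, abs_div, abs_of_nonneg (sq_nonneg h),
    div_le_iff₀ (by positivity)]
  have h1 : |1 + h| ≤ 3 / 2 := by
    rw [abs_le]
    constructor <;> linarith [abs_lt.mp hh |>.1, abs_lt.mp hh |>.2]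
  calc |-h ^ 3 / 2 + (1 + h) * (-h + h ^ 2 / 2 + Real.log (1 + h))|
      ≤ |-h ^ 3 / 2| + |(1 + h) * (-h + h ^ 2 / 2 + Real.log (1 + h))| := abs_add_le _ _
    _ ≤ |h| ^ 3 / 2 + 3 / 2 * (2 * |h| ^ 3) := by
        rw [abs_mul, abs_div, abs_neg, abs_pow, abs_two]
        gcongr
    _ ≤ 4 * |h| * h ^ 2 := by rw [← hsq]; nlinarith [pow_pos hpos 3]

/-- If `p - q` is of order `δ → 0` and `q → 1`, then `q * klFun (p / q)`, the integrand of the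
relative entropy, agrees with `(p - q) ^ 2 / 2`, the integrand of half the `χ²`-divergence, to
order `δ ^ 2`. The limit `c` of `(p - q) / δ` may be zero. -/
theorem tendsto_mul_klFun_div {ι : Type*} {l : Filter ι} {p q δ : ι → ℝ} {c : ℝ}
    (hq : Tendsto q l (𝓝 1)) (hδ : Tendsto δ l (𝓝 0)) (hδ0 : ∀ᶠ i in l, δ i ≠ 0)
    (hpq : Tendsto (fun i => (p i - q i) / δ i) l (𝓝 c)) :
    Tendsto (fun i => q i * klFun (p i / q i) / δ i ^ 2) l (𝓝 (c ^ 2 / 2)) := by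
  have hh : Tendsto (fun i => (p i - q i) / δ i / q i) l (𝓝 c) := by
    simpa [Pi.div_def] using hpq.div hq one_ne_zero
  have hh0 : Tendsto (fun i => (p i - q i) / δ i / q i * δ i) l (𝓝 0) := by
    simpa using hh.mul hδ
  have hlim := (hq.mul (tendsto_klFun_one_add_div_sq.comp hh0)).mul (hh.pow 2)
  have hc : 1 * (1 / 2) * c ^ 2 = c ^ 2 / 2 := by ring
  rw [hc] at hlim
  refine hlim.congr' ?_
  filter_upwards [hδ0, hq.eventually_ne one_ne_zero] with i hi hqi
  have hpq' : p i / q i = 1 + (p i - q i) / δ i / q i * δ i := by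
    field_simp
    ring
  rw [hpq', Function.comp_apply]
  generalize (p i - q i) / δ i / q i = a
  by_cases ha : a = 0
  · simp [ha, klFun_one]
  · rw [if_neg (mul_ne_zero ha hi)]
    field_simp

/-! ### Covariances over a finite space -/

section finite

variable {𝒮 : Type*} [Finite 𝒮] [MeasurableSpace 𝒮] [MeasurableSingletonClass 𝒮] {π : Measure 𝒮}
  [IsProbabilityMeasure π]

theorem tendsto_integral_of_finite {ι : Type*} {l : Filter ι} {F : ι → 𝒮 → ℝ} {G : 𝒮 → ℝ}
    (h : ∀ s, Tendsto (fun i => F i s) l (𝓝 (G s))) :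
    Tendsto (fun i => ∫ s, F i s ∂π) l (𝓝 (∫ s, G s ∂π)) := by
  have := Fintype.ofFinite 𝒮
  simp_rw [integral_fintype Integrable.of_finite]
  exact tendsto_finsetSum _ fun s _ => (h s).const_smul _

theorem covariance_eq_sub_of_finite (X Y : 𝒮 → ℝ) :
    cov[X, Y; π] = (∫ s, X s * Y s ∂π) - (∫ s, X s ∂π) * ∫ s, Y s ∂π :=
  covariance_eq_sub .of_discrete .of_discrete

theorem tendsto_covariance_of_finite {ι : Type*} {l : Filter ι} {F G : ι → 𝒮 → ℝ} {X Y : 𝒮 → ℝ}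
    (hF : ∀ s, Tendsto (fun i => F i s) l (𝓝 (X s)))
    (hG : ∀ s, Tendsto (fun i => G i s) l (𝓝 (Y s))) :
    Tendsto (fun i => cov[F i, G i; π]) l (𝓝 cov[X, Y; π]) := by
  simp_rw [covariance_eq_sub_of_finite]
  exact (tendsto_integral_of_finite fun s => (hF s).mul (hG s)).sub
    ((tendsto_integral_of_finite hF).mul (tendsto_integral_of_finite hG))

theorem abs_covariance_le_of_abs_le {X Y : 𝒮 → ℝ} {A B : ℝ} (hX : ∀ s, |X s| ≤ A)
    (hY : ∀ s, |Y s| ≤ B) : |cov[X, Y; π]| ≤ 2 * (A * B) := by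
  have : Nonempty 𝒮 := nonempty_of_isProbabilityMeasure π
  have hA : 0 ≤ A := (abs_nonneg _).trans (hX (Classical.arbitrary 𝒮))
  have h : ∀ (Z : 𝒮 → ℝ) (c : ℝ), (∀ s, |Z s| ≤ c) → |∫ s, Z s ∂π| ≤ c := fun Z c hZ => by
    simpa using norm_integral_le_of_norm_le_const (f := Z) (C := c) (μ := π) (ae_of_all _ hZ)
  rw [covariance_eq_sub_of_finite, two_mul]
  refine (abs_sub _ _).trans (add_le_add (h _ _ fun s => ?_) ?_)
  · rw [abs_mul]
    exact mul_le_mul (hX s) (hY s) (abs_nonneg _) hA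
  · rw [abs_mul]
    exact mul_le_mul (h _ _ hX) (h _ _ hY) (abs_nonneg _) hA

/-- The covariance of two linear forms is the bilinear form given by the cross-covariance matrix. -/
theorem covariance_inner_inner {d e : ℕ} (u : 𝒮 → EuclideanSpace ℝ (Fin d))
    (v : 𝒮 → EuclideanSpace ℝ (Fin e)) (x : EuclideanSpace ℝ (Fin d))
    (y : EuclideanSpace ℝ (Fin e)) :
    cov[fun s => ⟪u s, x⟫, fun s => ⟪v s, y⟫; π] =
      ∑ a, ∑ b, cov[fun s => u s a, fun s => v s b; π] * (x a * y b) := by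
  simp_rw [PiLp.inner_apply]
  rw [covariance_fun_sum_fun_sum (fun _ => .of_discrete) fun _ => .of_discrete]
  refine Finset.sum_congr rfl fun a _ => Finset.sum_congr rfl fun b _ => ?_
  simp only [RCLike.inner_apply, conj_trivial]
  rw [covariance_const_mul_left, covariance_const_mul_right]
  ring

end finite

/-! ### Cross-covariance matrices and their Frobenius norms -/

theorem crossCov_comp {Ω 𝒮 : Type*} [MeasurableSpace Ω] {μ : Measure Ω} [IsProbabilityMeasure μ]
    [Finite 𝒮] [MeasurableSpace 𝒮] [MeasurableSingletonClass 𝒮] {S : Ω → 𝒮} (hS : Measurable S)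
    {d e : ℕ} (u : 𝒮 → EuclideanSpace ℝ (Fin d)) (v : 𝒮 → EuclideanSpace ℝ (Fin e)) (a : Fin d)
    (b : Fin e) :
    crossCov (fun ω => u (S ω)) (fun ω => v (S ω)) μ a b =
      cov[fun s => u s a, fun s => v s b; μ.map S] := by
  have := Measure.isProbabilityMeasure_map (μ := μ) hS.aemeasurable
  have hmean : ∀ {k : ℕ} (w : 𝒮 → EuclideanSpace ℝ (Fin k)) (c : Fin k),
      (∫ ω, w (S ω) ∂μ) c = ∫ s, w s c ∂(μ.map S) := fun w c => by
    rw [← integral_map (f := w) hS.aemeasurable (measurable_of_countable w).aestronglyMeasurable]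
    exact ((EuclideanSpace.proj c : EuclideanSpace ℝ (Fin _) →L[ℝ] ℝ).integral_comp_comm
      Integrable.of_finite).symm
  rw [covariance, integral_map hS.aemeasurable (measurable_of_countable _).aestronglyMeasurable]
  simp only [crossCov, Matrix.of_apply, PiLp.sub_apply, hmean]

theorem frobeniusNorm_sq {d e : ℕ} (A : Matrix (Fin d) (Fin e) ℝ) :
    frobeniusNorm A ^ 2 = ∑ a, ∑ b, A a b ^ 2 := by
  have h0 : 0 ≤ ∑ a, ∑ b, A a b ^ 2 := by positivity
  rw [frobeniusNorm, Matrix.frobenius_norm_def, ← Real.sqrt_eq_rpow]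
  simp only [Real.rpow_two, Real.norm_eq_abs, sq_abs]
  exact Real.sq_sqrt h0

/-- Independent standard Gaussian vectors turn a bilinear form into the sum of the squares of its
coefficients. -/
theorem integral_bilin_sq_stdGaussian {d e : ℕ} (C : Matrix (Fin d) (Fin e) ℝ) :
    ∫ z, (∑ a, ∑ b, C a b * (z.1 a * z.2 b)) ^ 2
      ∂((stdGaussian (EuclideanSpace ℝ (Fin d))).prod (stdGaussian (EuclideanSpace ℝ (Fin e)))) =
      ∑ a, ∑ b, C a b ^ 2 := by
  have hexp : ∀ z : EuclideanSpace ℝ (Fin d) × EuclideanSpace ℝ (Fin e),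
      (∑ a, ∑ b, C a b * (z.1 a * z.2 b)) ^ 2 =
        ∑ p : Fin d × Fin e, ∑ p' : Fin d × Fin e,
          C p.1 p.2 * C p'.1 p'.2 * ((z.1 p.1 * z.1 p'.1) * (z.2 p.2 * z.2 p'.2)) := fun z => by
    rw [← Fintype.sum_prod_type' (fun a b => C a b * (z.1 a * z.2 b)), sq, Finset.sum_mul_sum]
    refine Finset.sum_congr rfl fun p _ => Finset.sum_congr rfl fun p' _ => ?_
    ring
  have hint : ∀ p p' : Fin d × Fin e,
      Integrable (fun z : EuclideanSpace ℝ (Fin d) × EuclideanSpace ℝ (Fin e) =>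
        C p.1 p.2 * C p'.1 p'.2 * ((z.1 p.1 * z.1 p'.1) * (z.2 p.2 * z.2 p'.2)))
      ((stdGaussian (EuclideanSpace ℝ (Fin d))).prod (stdGaussian (EuclideanSpace ℝ (Fin e)))) :=
    fun p p' => ((integrable_coord_mul_coord_stdGaussian p.1 p'.1).mul_prod
      (integrable_coord_mul_coord_stdGaussian p.2 p'.2)).const_mul _
  simp_rw [hexp]
  rw [integral_finsetSum _ fun p _ => integrable_finsetSum _ fun p' _ => hint p p',
    ← Fintype.sum_prod_type' (fun a b => C a b ^ 2)]
  refine Finset.sum_congr rfl fun p _ => ?_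
  rw [integral_finsetSum _ fun p' _ => hint p p']
  simp_rw [integral_const_mul]
  have hmom : ∀ p' : Fin d × Fin e,
      ∫ z : EuclideanSpace ℝ (Fin d) × EuclideanSpace ℝ (Fin e),
        (z.1 p.1 * z.1 p'.1) * (z.2 p.2 * z.2 p'.2)
        ∂((stdGaussian (EuclideanSpace ℝ (Fin d))).prod
          (stdGaussian (EuclideanSpace ℝ (Fin e)))) = if p = p' then 1 else 0 := fun p' => by
    rw [integral_prod_mul (fun x : EuclideanSpace ℝ (Fin d) => x p.1 * x p'.1)
      (fun y : EuclideanSpace ℝ (Fin e) => y p.2 * y p'.2), integral_coord_mul_coord_stdGaussian,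
      integral_coord_mul_coord_stdGaussian]
    simp only [Prod.ext_iff]
    split_ifs <;> simp_all
  simp [hmom, sq]

/-- The squared Frobenius norms of the blocks of a covariance matrix form a positive semidefinite
matrix: they are the block sums of the Hadamard square of that covariance matrix, which is positive
semidefinite by the Schur product theorem. -/
theorem posSemidef_sum_sq_covariance {𝒮 : Type*} [Finite 𝒮] [MeasurableSpace 𝒮]
    [MeasurableSingletonClass 𝒮] (π : Measure 𝒮) [IsProbabilityMeasure π] {n : ℕ} {d : Fin n → ℕ}
    (f : (i : Fin n) → 𝒮 → EuclideanSpace ℝ (Fin (d i))) :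
    (Matrix.of fun i j : Fin n => ∑ a, ∑ b,
      cov[fun s => f i s a, fun s => f j s b; π] ^ 2).PosSemidef := by
  let K : Matrix (Σ i, Fin (d i)) (Σ i, Fin (d i)) ℝ :=
    Matrix.of fun p q => cov[fun s => f p.1 s p.2, fun s => f q.1 s q.2; π]
  have hK : K.PosSemidef := by
    rw [Matrix.posSemidef_iff_dotProduct_mulVec]
    refine ⟨Matrix.IsHermitian.ext fun p q => covariance_comm _ _, fun x => ?_⟩
    have hvar : star x ⬝ᵥ K.mulVec x =
        cov[fun s => ∑ p, x p * f p.1 s p.2, fun s => ∑ p, x p * f p.1 s p.2; π] := by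
      rw [covariance_fun_sum_fun_sum (fun _ => .of_discrete) fun _ => .of_discrete]
      simp only [dotProduct, Matrix.mulVec, K, Matrix.of_apply, Finset.mul_sum, star_trivial,
        covariance_const_mul_left, covariance_const_mul_right]
      refine Finset.sum_congr rfl fun p _ => Finset.sum_congr rfl fun q _ => ?_
      ring
    rw [hvar, covariance_self (measurable_of_countable _).aemeasurable]
    exact variance_nonneg _ _
  have hKK := hK.hadamard hK
  rw [Matrix.posSemidef_iff_dotProduct_mulVec] at hKK ⊢
  refine ⟨Matrix.IsHermitian.ext fun i j => ?_, fun x => ?_⟩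
  · simp only [Matrix.of_apply, star_trivial]
    rw [Finset.sum_comm]
    simp_rw [covariance_comm (fun s => f j s _)]
  -- test the Hadamard square on the vector that is constant on each block
  refine (hKK.2 fun p => x p.1).trans_eq ?_
  simp only [dotProduct, Matrix.mulVec, K, Matrix.of_apply, Pi.star_apply, star_trivial,
    Matrix.hadamard_apply, Fintype.sum_sigma, Finset.mul_sum, Finset.sum_mul]
  refine Finset.sum_congr rfl fun i _ => ?_
  rw [Finset.sum_comm]
  refine Finset.sum_congr rfl fun j _ => Finset.sum_congr rfl fun a _ =>
    Finset.sum_congr rfl fun b _ => ?_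
  ring

/-! ### Gaussian likelihood ratios -/

theorem abs_exp_sub_one_le_mul_exp_abs (θ : ℝ) : |Real.exp θ - 1| ≤ |θ| * Real.exp |θ| := by
  rcases le_total 0 θ with h | h
  · have h1 : 1 - θ ≤ Real.exp (-θ) := by linarith [Real.add_one_le_exp (-θ)]
    have h2 : Real.exp (-θ) * Real.exp θ = 1 := by rw [← Real.exp_add]; simp
    rw [abs_of_nonneg h, abs_of_nonneg (by linarith [Real.one_le_exp h])]
    nlinarith [mul_le_mul_of_nonneg_right h1 (Real.exp_pos θ).le]
  · rw [abs_of_nonpos h, abs_of_nonpos (by linarith [Real.exp_le_one_iff.mpr h])]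
    nlinarith [Real.add_one_le_exp θ, Real.one_le_exp (neg_nonneg.mpr h)]

/-- A bound, growing linearly in `‖z‖`, on the exponent of `gaussianLik (ε • w) z` divided by `ε`,
for `‖w‖ ≤ M` and `ε ≤ R`. -/
def exponentBound {E : Type*} [NormedAddCommGroup E] (M R : ℝ) (z : E) : ℝ := M * ‖z‖ + R * M ^ 2 / 2

theorem exponentBound_nonneg {E : Type*} [NormedAddCommGroup E] {M R : ℝ} (hM : 0 ≤ M) (hR : 0 ≤ R)
    (z : E) : 0 ≤ exponentBound M R z := by
  unfold exponentBound
  positivity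

section likelihood

variable {E : Type*} [NormedAddCommGroup E] [InnerProductSpace ℝ E]

theorem gaussianLik_pos (w z : E) : 0 < gaussianLik w z := Real.exp_pos _

theorem measurable_gaussianLik [MeasurableSpace E] [BorelSpace E] [SecondCountableTopology E]
    (w : E) : Measurable (gaussianLik w) := by
  unfold gaussianLik
  fun_prop

theorem abs_exponent_le {M R ε : ℝ} (hε0 : 0 ≤ ε) (hεR : ε ≤ R) {w : E} (hw : ‖w‖ ≤ M) (z : E) :
    |⟪ε • w, z⟫ - ‖ε • w‖ ^ 2 / 2| ≤ ε * exponentBound M R z := by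
  have hM : 0 ≤ M := (norm_nonneg _).trans hw
  rw [real_inner_smul_left, norm_smul, Real.norm_of_nonneg hε0]
  have h1 : |⟪w, z⟫| ≤ M * ‖z‖ :=
    (abs_real_inner_le_norm w z).trans (mul_le_mul_of_nonneg_right hw (norm_nonneg z))
  have h2 : ε * ‖w‖ ^ 2 ≤ R * M ^ 2 := by gcongr; exact hε0.trans hεR
  calc |ε * ⟪w, z⟫ - (ε * ‖w‖) ^ 2 / 2| = ε * |⟪w, z⟫ - ε * ‖w‖ ^ 2 / 2| := by
        rw [← abs_of_nonneg hε0, ← abs_mul, abs_of_nonneg hε0]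
        ring_nf
    _ ≤ ε * (|⟪w, z⟫| + |ε * ‖w‖ ^ 2 / 2|) := by gcongr; exact abs_sub _ _
    _ ≤ ε * exponentBound M R z := by
        rw [exponentBound, abs_of_nonneg (by positivity : 0 ≤ ε * ‖w‖ ^ 2 / 2)]
        gcongr

theorem abs_gaussianLik_sub_one_le {M R ε : ℝ} (hε0 : 0 ≤ ε) (hεR : ε ≤ R) {w : E}
    (hw : ‖w‖ ≤ M) (z : E) :
    |gaussianLik (ε • w) z - 1| ≤ ε * Real.exp ((R + 1) * exponentBound M R z) := by
  have hA := exponentBound_nonneg ((norm_nonneg _).trans hw) (hε0.trans hεR) z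
  have hθ := abs_exponent_le hε0 hεR hw z
  set A := exponentBound M R z
  calc |gaussianLik (ε • w) z - 1| ≤ _ := abs_exp_sub_one_le_mul_exp_abs _
    _ ≤ (ε * A) * Real.exp (R * A) := by
        gcongr
        exact hθ.trans (mul_le_mul_of_nonneg_right hεR hA)
    _ ≤ (ε * Real.exp A) * Real.exp (R * A) := by
        gcongr
        linarith [Real.add_one_le_exp A]
    _ = ε * Real.exp ((R + 1) * A) := by
        rw [mul_assoc, ← Real.exp_add]
        ring_nf

theorem exp_neg_le_gaussianLik {M R ε : ℝ} (hε0 : 0 ≤ ε) (hεR : ε ≤ R) {w : E}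
    (hw : ‖w‖ ≤ M) (z : E) :
    Real.exp (-(R * exponentBound M R z)) ≤ gaussianLik (ε • w) z := by
  have hA := exponentBound_nonneg ((norm_nonneg _).trans hw) (hε0.trans hεR) z
  refine Real.exp_le_exp.mpr ?_
  linarith [neg_abs_le (⟪ε • w, z⟫ - ‖ε • w‖ ^ 2 / 2), abs_exponent_le hε0 hεR hw z,
    mul_le_mul_of_nonneg_right hεR hA]

theorem tendsto_gaussianLik_smul (w z : E) :
    Tendsto (fun ε : ℝ => gaussianLik (ε • w) z) (𝓝 0) (𝓝 1) := by
  have h : Continuous fun ε : ℝ => gaussianLik (ε • w) z := by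
    unfold gaussianLik
    fun_prop
  simpa [gaussianLik] using h.tendsto 0

theorem tendsto_gaussianLik_sub_one_div (w z : E) :
    Tendsto (fun ε : ℝ => (gaussianLik (ε • w) z - 1) / ε) (𝓝[>] 0) (𝓝 ⟪w, z⟫) := by
  have hfun : (fun ε : ℝ => gaussianLik (ε • w) z) =
      fun ε => Real.exp (ε * ⟪w, z⟫ - ε ^ 2 * (‖w‖ ^ 2 / 2)) := by
    ext ε
    rw [gaussianLik, real_inner_smul_left, norm_smul, mul_pow, Real.norm_eq_abs, sq_abs]
    ring_nf
  have hderiv : HasDerivAt (fun ε : ℝ => gaussianLik (ε • w) z) ⟪w, z⟫ 0 := by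
    rw [hfun]
    have := (((hasDerivAt_id (0 : ℝ)).mul_const ⟪w, z⟫).sub
      (((hasDerivAt_id (0 : ℝ)).pow 2).mul_const (‖w‖ ^ 2 / 2))).exp
    simpa using this
  have hslope := hderiv.tendsto_slope.mono_left
    (nhdsWithin_mono 0 fun ε (hε : 0 < ε) => hε.ne')
  refine hslope.congr fun ε => ?_
  simp [slope_def_field, gaussianLik]

end likelihood

theorem integrable_exp_exponentBound_stdGaussian {d : ℕ} (K M R : ℝ) :
    Integrable (fun x => Real.exp (K * exponentBound M R x))
      (stdGaussian (EuclideanSpace ℝ (Fin d))) := by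
  refine ((integrable_exp_mul_norm_stdGaussian (d := d) (K * M)).const_mul
    (Real.exp (K * (R * M ^ 2 / 2)))).congr (ae_of_all _ fun x => ?_)
  simp only [exponentBound]
  rw [← Real.exp_add]
  ring_nf

theorem exists_norm_le_of_finite {𝒮 : Type*} [Finite 𝒮] {d e : ℕ}
    (u : 𝒮 → EuclideanSpace ℝ (Fin d)) (v : 𝒮 → EuclideanSpace ℝ (Fin e)) :
    ∃ M, (∀ s, ‖u s‖ ≤ M) ∧ ∀ s, ‖v s‖ ≤ M := by
  obtain ⟨M, hM⟩ := Finite.exists_le fun s => max ‖u s‖ ‖v s‖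
  exact ⟨M, fun s => (le_max_left _ _).trans (hM s), fun s => (le_max_right _ _).trans (hM s)⟩

/-! ### Densities of the channel outputs -/

section channel

variable {𝒮 : Type*} [MeasurableSpace 𝒮] {d e : ℕ}

/-- The density, with respect to the standard Gaussian measure, of the law of `u S + W` where `S`
has law `π` and `W` is an independent standard Gaussian vector. -/
def outputDensity (π : Measure 𝒮) (u : 𝒮 → EuclideanSpace ℝ (Fin d))
    (x : EuclideanSpace ℝ (Fin d)) : ℝ :=
  ∫ s, gaussianLik (u s) x ∂π

/-- The density, with respect to the product of the standard Gaussian measures, of the joint law of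
`u S + W` and `v S + W'` where `S` has law `π` and `W`, `W'` are standard Gaussian vectors that are
independent of each other and of `S`. -/
def jointDensity (π : Measure 𝒮) (u : 𝒮 → EuclideanSpace ℝ (Fin d))
    (v : 𝒮 → EuclideanSpace ℝ (Fin e))
    (z : EuclideanSpace ℝ (Fin d) × EuclideanSpace ℝ (Fin e)) : ℝ :=
  ∫ s, gaussianLik (u s) z.1 * gaussianLik (v s) z.2 ∂π

/-- The function whose integral against the product of the standard Gaussian measures is the mutual
information of `u S + W` and `v S + W'`, where `S` has law `π`. The reference density in the
denominator is everywhere positive, so the division is harmless. -/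
def infoIntegrand (π : Measure 𝒮) (u : 𝒮 → EuclideanSpace ℝ (Fin d))
    (v : 𝒮 → EuclideanSpace ℝ (Fin e))
    (z : EuclideanSpace ℝ (Fin d) × EuclideanSpace ℝ (Fin e)) : ℝ :=
  outputDensity π u z.1 * outputDensity π v z.2 *
    klFun (jointDensity π u v z / (outputDensity π u z.1 * outputDensity π v z.2))

theorem jointDensity_nonneg (π : Measure 𝒮) (u : 𝒮 → EuclideanSpace ℝ (Fin d))
    (v : 𝒮 → EuclideanSpace ℝ (Fin e))
    (z : EuclideanSpace ℝ (Fin d) × EuclideanSpace ℝ (Fin e)) : 0 ≤ jointDensity π u v z :=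
  integral_nonneg fun _ => (mul_pos (gaussianLik_pos _ _) (gaussianLik_pos _ _)).le

variable [Finite 𝒮] [MeasurableSingletonClass 𝒮]

theorem measurable_outputDensity (π : Measure 𝒮) [IsProbabilityMeasure π]
    (u : 𝒮 → EuclideanSpace ℝ (Fin d)) : Measurable (outputDensity π u) := by
  have := Fintype.ofFinite 𝒮
  unfold outputDensity
  simp_rw [integral_fintype Integrable.of_finite]
  refine Finset.measurable_sum _ fun s _ => ?_
  have := measurable_gaussianLik (u s)
  fun_prop

theorem measurable_jointDensity (π : Measure 𝒮) [IsProbabilityMeasure π]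
    (u : 𝒮 → EuclideanSpace ℝ (Fin d)) (v : 𝒮 → EuclideanSpace ℝ (Fin e)) :
    Measurable (jointDensity π u v) := by
  have := Fintype.ofFinite 𝒮
  unfold jointDensity
  simp_rw [integral_fintype Integrable.of_finite]
  refine Finset.measurable_sum _ fun s _ => ?_
  have := measurable_gaussianLik (u s)
  have := measurable_gaussianLik (v s)
  fun_prop

theorem measurable_infoIntegrand (π : Measure 𝒮) [IsProbabilityMeasure π]
    (u : 𝒮 → EuclideanSpace ℝ (Fin d)) (v : 𝒮 → EuclideanSpace ℝ (Fin e)) :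
    Measurable (infoIntegrand π u v) := by
  have hq := ((measurable_outputDensity π u).comp measurable_fst).mul
    ((measurable_outputDensity π v).comp measurable_snd)
  exact hq.mul (measurable_klFun.comp ((measurable_jointDensity π u v).div hq))

theorem le_outputDensity {π : Measure 𝒮} [IsProbabilityMeasure π]
    {u : 𝒮 → EuclideanSpace ℝ (Fin d)} {x : EuclideanSpace ℝ (Fin d)} {c : ℝ}
    (h : ∀ s, c ≤ gaussianLik (u s) x) : c ≤ outputDensity π u x := by
  simpa [outputDensity] using integral_mono (μ := π) (integrable_const c) Integrable.of_finite h

theorem outputDensity_pos (π : Measure 𝒮) [IsProbabilityMeasure π]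
    (u : 𝒮 → EuclideanSpace ℝ (Fin d)) (x : EuclideanSpace ℝ (Fin d)) :
    0 < outputDensity π u x := by
  have : Nonempty 𝒮 := nonempty_of_isProbabilityMeasure π
  obtain ⟨s, hs⟩ := Finite.exists_min fun s => gaussianLik (u s) x
  exact (gaussianLik_pos _ _).trans_le (le_outputDensity hs)

theorem infoIntegrand_nonneg (π : Measure 𝒮) [IsProbabilityMeasure π]
    (u : 𝒮 → EuclideanSpace ℝ (Fin d)) (v : 𝒮 → EuclideanSpace ℝ (Fin e))
    (z : EuclideanSpace ℝ (Fin d) × EuclideanSpace ℝ (Fin e)) : 0 ≤ infoIntegrand π u v z := by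
  have hq := mul_pos (outputDensity_pos π u z.1) (outputDensity_pos π v z.2)
  exact mul_nonneg hq.le (klFun_nonneg (div_nonneg (jointDensity_nonneg π u v z) hq.le))

/-- The deviation of the joint density from the product of the marginal densities is a covariance of
likelihood ratios; subtracting `1` from these makes both factors of order `ε` when the signals are
scaled by `ε`. -/
theorem jointDensity_sub_eq_covariance (π : Measure 𝒮) [IsProbabilityMeasure π]
    (u : 𝒮 → EuclideanSpace ℝ (Fin d)) (v : 𝒮 → EuclideanSpace ℝ (Fin e))
    (z : EuclideanSpace ℝ (Fin d) × EuclideanSpace ℝ (Fin e)) :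
    jointDensity π u v z - outputDensity π u z.1 * outputDensity π v z.2 =
      cov[fun s => gaussianLik (u s) z.1 - 1, fun s => gaussianLik (v s) z.2 - 1; π] := by
  rw [covariance_sub_const_left Integrable.of_finite,
    covariance_sub_const_right Integrable.of_finite, covariance_eq_sub_of_finite]
  rfl

/-- The domination used to pass to the limit under the integral. The `χ²` bound on `klFun` reduces
it to a square of a covariance of two functions of size `ε`, divided by a density that is at least
the exponential of minus a linear function of the norms. -/
theorem infoIntegrand_smul_le (π : Measure 𝒮) [IsProbabilityMeasure π]
    {u : 𝒮 → EuclideanSpace ℝ (Fin d)} {v : 𝒮 → EuclideanSpace ℝ (Fin e)} {M R ε : ℝ}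
    (hu : ∀ s, ‖u s‖ ≤ M) (hv : ∀ s, ‖v s‖ ≤ M) (hε0 : 0 ≤ ε) (hεR : ε ≤ R)
    (z : EuclideanSpace ℝ (Fin d) × EuclideanSpace ℝ (Fin e)) :
    infoIntegrand π (fun s => ε • u s) (fun s => ε • v s) z ≤
      ε ^ 4 * (4 * (Real.exp ((3 * R + 2) * exponentBound M R z.1) *
        Real.exp ((3 * R + 2) * exponentBound M R z.2))) := by
  refine (mul_klFun_div_le (jointDensity_nonneg _ _ _ _)
    (mul_pos (outputDensity_pos _ _ _) (outputDensity_pos _ _ _))).trans ?_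
  rw [jointDensity_sub_eq_covariance]
  have hcov := abs_covariance_le_of_abs_le (π := π)
    (fun s => abs_gaussianLik_sub_one_le hε0 hεR (hu s) z.1)
    (fun s => abs_gaussianLik_sub_one_le hε0 hεR (hv s) z.2)
  have ha := le_outputDensity (π := π) fun s => exp_neg_le_gaussianLik hε0 hεR (hu s) z.1
  have hb := le_outputDensity (π := π) fun s => exp_neg_le_gaussianLik hε0 hεR (hv s) z.2
  set A := exponentBound M R z.1
  set B := exponentBound M R z.2
  rw [div_le_iff₀ (mul_pos (outputDensity_pos _ _ _) (outputDensity_pos _ _ _)), ← sq_abs]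
  calc _ ≤ (2 * (ε * Real.exp ((R + 1) * A) * (ε * Real.exp ((R + 1) * B)))) ^ 2 := by gcongr
    _ = ε ^ 4 * (4 * (Real.exp ((3 * R + 2) * A) * Real.exp ((3 * R + 2) * B))) *
        (Real.exp (-(R * A)) * Real.exp (-(R * B))) := by
        have h : ∀ c : ℝ, Real.exp ((3 * R + 2) * c) * Real.exp (-(R * c)) =
            Real.exp ((R + 1) * c) ^ 2 := fun c => by
          rw [← Real.exp_add, sq, ← Real.exp_add]
          ring_nf
        linear_combination (-4 * ε ^ 4 * Real.exp ((R + 1) * B) ^ 2) * h A +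
          (-4 * ε ^ 4 * (Real.exp ((3 * R + 2) * A) * Real.exp (-(R * A)))) * h B
    _ ≤ _ := by
        gcongr
        exact (outputDensity_pos _ _ _).le

theorem integrable_infoIntegrand_bound (d e : ℕ) (K M R : ℝ) :
    Integrable (fun z : EuclideanSpace ℝ (Fin d) × EuclideanSpace ℝ (Fin e) =>
      4 * (Real.exp (K * exponentBound M R z.1) * Real.exp (K * exponentBound M R z.2)))
      ((stdGaussian (EuclideanSpace ℝ (Fin d))).prod (stdGaussian (EuclideanSpace ℝ (Fin e)))) :=
  ((integrable_exp_exponentBound_stdGaussian K M R).mul_prod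
    (integrable_exp_exponentBound_stdGaussian K M R)).const_mul 4

theorem integrable_infoIntegrand (π : Measure 𝒮) [IsProbabilityMeasure π]
    (u : 𝒮 → EuclideanSpace ℝ (Fin d)) (v : 𝒮 → EuclideanSpace ℝ (Fin e)) :
    Integrable (infoIntegrand π u v)
      ((stdGaussian (EuclideanSpace ℝ (Fin d))).prod
        (stdGaussian (EuclideanSpace ℝ (Fin e)))) := by
  obtain ⟨M, hu, hv⟩ := exists_norm_le_of_finite u v
  refine (integrable_infoIntegrand_bound d e (3 * 1 + 2) M 1).mono'
    (measurable_infoIntegrand π u v).aestronglyMeasurable (ae_of_all _ fun z => ?_)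
  rw [Real.norm_of_nonneg (infoIntegrand_nonneg _ _ _ _)]
  simpa using infoIntegrand_smul_le π hu hv zero_le_one le_rfl z

/-! ### Expansion of the mutual information at low signal-to-noise ratio -/

theorem tendsto_infoIntegrand_smul (π : Measure 𝒮) [IsProbabilityMeasure π]
    (u : 𝒮 → EuclideanSpace ℝ (Fin d)) (v : 𝒮 → EuclideanSpace ℝ (Fin e))
    (z : EuclideanSpace ℝ (Fin d) × EuclideanSpace ℝ (Fin e)) :
    Tendsto (fun ε : ℝ => infoIntegrand π (fun s => ε • u s) (fun s => ε • v s) z / ε ^ 4)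
      (𝓝[>] 0) (𝓝 (cov[fun s => ⟪u s, z.1⟫, fun s => ⟪v s, z.2⟫; π] ^ 2 / 2)) := by
  have hout : ∀ {k : ℕ} (w : 𝒮 → EuclideanSpace ℝ (Fin k)) (x : EuclideanSpace ℝ (Fin k)),
      Tendsto (fun ε : ℝ => outputDensity π (fun s => ε • w s) x) (𝓝[>] 0) (𝓝 1) := fun w x => by
    have h := tendsto_integral_of_finite (π := π) fun s =>
      (tendsto_gaussianLik_smul (w s) x).mono_left (nhdsWithin_le_nhds (s := Set.Ioi 0))
    simpa [outputDensity, gaussianLik] using h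
  have hq : Tendsto (fun ε : ℝ => outputDensity π (fun s => ε • u s) z.1 *
      outputDensity π (fun s => ε • v s) z.2) (𝓝[>] 0) (𝓝 1) := by
    simpa using (hout u z.1).mul (hout v z.2)
  have hδ : Tendsto (fun ε : ℝ => ε ^ 2) (𝓝[>] 0) (𝓝 0) := by
    have h : Continuous fun ε : ℝ => ε ^ 2 := by fun_prop
    simpa using (h.tendsto 0).mono_left nhdsWithin_le_nhds
  have hpos : ∀ᶠ ε : ℝ in 𝓝[>] 0, 0 < ε := self_mem_nhdsWithin
  have hpq : Tendsto (fun ε : ℝ => (jointDensity π (fun s => ε • u s) (fun s => ε • v s) z -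
      outputDensity π (fun s => ε • u s) z.1 * outputDensity π (fun s => ε • v s) z.2) / ε ^ 2)
      (𝓝[>] 0) (𝓝 cov[fun s => ⟪u s, z.1⟫, fun s => ⟪v s, z.2⟫; π]) := by
    refine (tendsto_covariance_of_finite (fun s => tendsto_gaussianLik_sub_one_div (u s) z.1)
      fun s => tendsto_gaussianLik_sub_one_div (v s) z.2).congr fun ε => ?_
    rw [jointDensity_sub_eq_covariance, covariance_fun_div_left, covariance_fun_div_right,
      div_div, sq]
  refine (tendsto_mul_klFun_div hq hδ (hpos.mono fun ε hε => (pow_pos hε 2).ne') hpq).congr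
    fun ε => ?_
  rw [infoIntegrand, ← pow_mul]

theorem tendsto_integral_infoIntegrand_smul (π : Measure 𝒮) [IsProbabilityMeasure π]
    (u : 𝒮 → EuclideanSpace ℝ (Fin d)) (v : 𝒮 → EuclideanSpace ℝ (Fin e)) :
    Tendsto (fun ε : ℝ => ∫ z, infoIntegrand π (fun s => ε • u s) (fun s => ε • v s) z / ε ^ 4
        ∂((stdGaussian (EuclideanSpace ℝ (Fin d))).prod (stdGaussian (EuclideanSpace ℝ (Fin e)))))
      (𝓝[>] 0)
      (𝓝 (1 / 2 * ∑ a, ∑ b, cov[fun s => u s a, fun s => v s b; π] ^ 2)) := by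
  obtain ⟨M, hu, hv⟩ := exists_norm_le_of_finite u v
  have hlim := tendsto_integral_filter_of_dominated_convergence _
    (Eventually.of_forall fun ε : ℝ =>
      ((measurable_infoIntegrand π (fun s => ε • u s) fun s => ε • v s).div_const
        (ε ^ 4)).aestronglyMeasurable) ?_ (integrable_infoIntegrand_bound d e (3 * 1 + 2) M 1)
    (ae_of_all _ fun z => tendsto_infoIntegrand_smul π u v z)
  · convert hlim using 2
    simp_rw [covariance_inner_inner, integral_div]
    have h := integral_bilin_sq_stdGaussian
      (Matrix.of fun a b => cov[fun s => u s a, fun s => v s b; π])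
    simp only [Matrix.of_apply] at h
    rw [h]
    ring
  · filter_upwards [Ioc_mem_nhdsGT (zero_lt_one' ℝ)] with ε hε
    refine ae_of_all _ fun z => ?_
    rw [Real.norm_of_nonneg (div_nonneg (infoIntegrand_nonneg _ _ _ _) (by positivity)),
      div_le_iff₀' (pow_pos hε.1 4)]
    exact infoIntegrand_smul_le π hu hv hε.1.le hε.2 z

/-- The mutual information of two Gaussian channels with the same input and independent noises, as an
integral against the law of the noises. In particular it is finite. -/
theorem mutualInfo_gaussianOutput {Ω : Type*} [MeasurableSpace Ω] {μ : Measure Ω}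
    [IsProbabilityMeasure μ] {S : Ω → 𝒮} (hS : Measurable S)
    {W : Ω → EuclideanSpace ℝ (Fin d)} {W' : Ω → EuclideanSpace ℝ (Fin e)}
    (hW : HasLaw W (stdGaussian (EuclideanSpace ℝ (Fin d))) μ)
    (hW' : HasLaw W' (stdGaussian (EuclideanSpace ℝ (Fin e))) μ) (hind : IndepFun W W' μ)
    (hSW : IndepFun S (fun ω => (W ω, W' ω)) μ) (u : 𝒮 → EuclideanSpace ℝ (Fin d))
    (v : 𝒮 → EuclideanSpace ℝ (Fin e)) (t : ℝ) :
    mutualInfo (gaussianOutput u S W t) (gaussianOutput v S W' t) μ =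
      ENNReal.ofReal (∫ z, infoIntegrand (μ.map S) (fun s => √t • u s) (fun s => √t • v s) z
        ∂((stdGaussian (EuclideanSpace ℝ (Fin d))).prod
          (stdGaussian (EuclideanSpace ℝ (Fin e))))) := by
  have hprob := Measure.isProbabilityMeasure_map (μ := μ) hS.aemeasurable
  have hmarg : ∀ {k : ℕ} {V : Ω → EuclideanSpace ℝ (Fin k)} (w : 𝒮 → EuclideanSpace ℝ (Fin k)),
      HasLaw V (stdGaussian (EuclideanSpace ℝ (Fin k))) μ → IndepFun S V μ →
      μ.map (gaussianOutput w S V t) = (stdGaussian (EuclideanSpace ℝ (Fin k))).withDensity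
        fun x => ENNReal.ofReal (outputDensity (μ.map S) (fun s => √t • w s) x) :=
    fun w hV hSV => map_randomShift_eq_withDensity hS hV hSV (T := fun s x => √t • w s + x)
      (fun s => by fun_prop) (fun s => measurable_gaussianLik (√t • w s))
      (fun s z => (gaussianLik_pos _ _).le) fun s => stdGaussian_map_const_add _
  have hX := hmarg u hW (hSW.comp measurable_id measurable_fst)
  have hY := hmarg v hW' (hSW.comp measurable_id measurable_snd)
  have hXY : μ.map (fun ω => (gaussianOutput u S W t ω, gaussianOutput v S W' t ω)) =
      ((stdGaussian (EuclideanSpace ℝ (Fin d))).prod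
        (stdGaussian (EuclideanSpace ℝ (Fin e)))).withDensity fun z =>
          ENNReal.ofReal (jointDensity (μ.map S) (fun s => √t • u s) (fun s => √t • v s) z) := by
    refine map_randomShift_eq_withDensity hS (hind.hasLaw_prod hW hW') hSW
      (T := fun s z => (√t • u s + z.1, √t • v s + z.2)) (fun s => by fun_prop)
      (L := fun s z => gaussianLik (√t • u s) z.1 * gaussianLik (√t • v s) z.2)
      (fun s => ((measurable_gaussianLik (√t • u s)).comp measurable_fst).mul
        ((measurable_gaussianLik (√t • v s)).comp measurable_snd))
      (fun s z => (mul_pos (gaussianLik_pos _ _) (gaussianLik_pos _ _)).le) fun s => ?_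
    have hmap := Measure.map_prod_map (stdGaussian (EuclideanSpace ℝ (Fin d)))
      (stdGaussian (EuclideanSpace ℝ (Fin e))) (measurable_const_add (√t • u s))
      (measurable_const_add (√t • v s))
    rw [stdGaussian_map_const_add, stdGaussian_map_const_add,
      prod_withDensity (measurable_gaussianLik _).ennreal_ofReal
        (measurable_gaussianLik _).ennreal_ofReal] at hmap
    refine hmap.symm.trans ?_
    simp_rw [← ENNReal.ofReal_mul (gaussianLik_pos _ _).le]
  have hprod : (μ.map (gaussianOutput u S W t)).prod (μ.map (gaussianOutput v S W' t)) =
      ((stdGaussian (EuclideanSpace ℝ (Fin d))).prod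
        (stdGaussian (EuclideanSpace ℝ (Fin e)))).withDensity fun z =>
          ENNReal.ofReal (outputDensity (μ.map S) (fun s => √t • u s) z.1 *
            outputDensity (μ.map S) (fun s => √t • v s) z.2) := by
    rw [hX, hY, prod_withDensity (measurable_outputDensity _ _).ennreal_ofReal
      (measurable_outputDensity _ _).ennreal_ofReal]
    simp_rw [← ENNReal.ofReal_mul (outputDensity_pos (μ.map S) _ _).le]
  have hfin : IsFiniteMeasure (((stdGaussian (EuclideanSpace ℝ (Fin d))).prod
      (stdGaussian (EuclideanSpace ℝ (Fin e)))).withDensity fun z =>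
        ENNReal.ofReal (jointDensity (μ.map S) (fun s => √t • u s) (fun s => √t • v s) z)) := by
    rw [← hXY]
    infer_instance
  have hfin' : IsFiniteMeasure (((stdGaussian (EuclideanSpace ℝ (Fin d))).prod
      (stdGaussian (EuclideanSpace ℝ (Fin e)))).withDensity fun z =>
        ENNReal.ofReal (outputDensity (μ.map S) (fun s => √t • u s) z.1 *
          outputDensity (μ.map S) (fun s => √t • v s) z.2)) := by
    rw [← hprod]
    infer_instance
  have hq : Measurable fun z : EuclideanSpace ℝ (Fin d) × EuclideanSpace ℝ (Fin e) =>
      outputDensity (μ.map S) (fun s => √t • u s) z.1 *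
        outputDensity (μ.map S) (fun s => √t • v s) z.2 :=
    ((measurable_outputDensity _ _).comp measurable_fst).mul
      ((measurable_outputDensity _ _).comp measurable_snd)
  rw [mutualInfo, hXY, hprod, ofReal_integral_eq_lintegral_ofReal (integrable_infoIntegrand _ _ _)
    (ae_of_all _ (infoIntegrand_nonneg _ _ _))]
  exact klDiv_withDensity_withDensity
    (measurable_jointDensity (μ.map S) (fun s => √t • u s) fun s => √t • v s) hq
    (jointDensity_nonneg _ _ _) fun z => mul_pos (outputDensity_pos _ _ _) (outputDensity_pos _ _ _)

end channel

end

theorem proposition3p1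
    {Ω 𝒮 : Type*} [MeasurableSpace Ω] (μ : Measure Ω) [IsProbabilityMeasure μ]
    [Finite 𝒮] [MeasurableSpace 𝒮] [MeasurableSingletonClass 𝒮]
    (S : Ω → 𝒮) (hS : Measurable S)
    (n : ℕ) (d : Fin n → ℕ)
    (f : (i : Fin n) → 𝒮 → EuclideanSpace ℝ (Fin (d i)))
    (W W' : (i : Fin n) → Ω → EuclideanSpace ℝ (Fin (d i)))
    -- all the noise vectors are standard Gaussian
    (hW : ∀ i, HasLaw (W i) (stdGaussian (EuclideanSpace ℝ (Fin (d i)))) μ)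
    (hW' : ∀ i, HasLaw (W' i) (stdGaussian (EuclideanSpace ℝ (Fin (d i)))) μ)
    -- the `2 n` noise vectors are mutually independent
    (hindep : iIndepFun (fun (p : Fin n × Bool) => if p.2 then W' p.1 else W p.1) μ)
    -- the whole noise is independent of the signal
    (hSindep : IndepFun S (fun ω => (fun i => W i ω, fun i => W' i ω)) μ) :
    (∀ i j : Fin n,
      (∀ t : ℝ, 0 ≤ t →
        mutualInfo (gaussianOutput (f i) S (W i) t) (gaussianOutput (f j) S (W' j) t) μ ≠ ⊤) ∧
      Tendsto
        (fun t : ℝ => (t ^ 2)⁻¹ *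
          (mutualInfo (gaussianOutput (f i) S (W i) t)
            (gaussianOutput (f j) S (W' j) t) μ).toReal)
        (𝓝[>] 0)
        (𝓝 ((1 / 2 : ℝ) *
          frobeniusNorm (crossCov (fun ω => f i (S ω)) (fun ω => f j (S ω)) μ) ^ 2))) ∧
    (Matrix.of fun i j : Fin n =>
      frobeniusNorm (crossCov (fun ω => f i (S ω)) (fun ω => f j (S ω)) μ) ^ 2).PosSemidef := by
  have hπ := Measure.isProbabilityMeasure_map (μ := μ) hS.aemeasurable
  have hnorm : ∀ i j : Fin n,
      frobeniusNorm (crossCov (fun ω => f i (S ω)) (fun ω => f j (S ω)) μ) ^ 2 =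
        ∑ a, ∑ b, cov[fun s => f i s a, fun s => f j s b; μ.map S] ^ 2 := fun i j => by
    simp_rw [frobeniusNorm_sq, crossCov_comp hS]
  have hinfo := fun (i j : Fin n) (t : ℝ) => by
    have hind : IndepFun (W i) (W' j) μ :=
      hindep.indepFun (i := (i, false)) (j := (j, true)) (by simp)
    have hpair : Measurable fun p : ((i : Fin n) → EuclideanSpace ℝ (Fin (d i))) ×
        ((i : Fin n) → EuclideanSpace ℝ (Fin (d i))) => (p.1 i, p.2 j) := by fun_prop
    exact mutualInfo_gaussianOutput hS (hW i) (hW' j) hind (hSindep.comp measurable_id hpair)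
      (f i) (f j) t
  simp_rw [hnorm]
  refine ⟨fun i j => ⟨fun t _ => ?_, ?_⟩, posSemidef_sum_sq_covariance (μ.map S) f⟩
  · rw [hinfo]
    exact ENNReal.ofReal_ne_top
  have hsqrt : Tendsto Real.sqrt (𝓝[>] 0) (𝓝[>] 0) := by
    refine tendsto_nhdsWithin_iff.mpr ⟨?_, ?_⟩
    · simpa using (Real.continuous_sqrt.tendsto 0).mono_left nhdsWithin_le_nhds
    · filter_upwards [self_mem_nhdsWithin] with t ht using Real.sqrt_pos.mpr ht
  refine ((tendsto_integral_infoIntegrand_smul (μ.map S) (f i) (f j)).comp hsqrt).congr' ?_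
  filter_upwards [self_mem_nhdsWithin] with t ht
  have h4 : √t ^ 4 = t ^ 2 := by
    rw [show 4 = 2 * 2 from rfl, pow_mul, Real.sq_sqrt (le_of_lt ht)]
  rw [hinfo, ENNReal.toReal_ofReal (integral_nonneg (infoIntegrand_nonneg _ _ _)),
    Function.comp_apply, integral_div, h4, div_eq_inv_mul]
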